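/- Let $D=(V,A)$ be a finite directed graph with capacities $u_a>0$, transit times $\tau_a\ge 0$ and costs $c_a\in\mathbb{R}$ on the arcs $a\in A$ such that no directed cycle has negative cost. Let $S^+,S^-\subseteq V$ be disjoint sets of sources and sinks with supplies $b_s>0$ ($s\in S^+$) and demands $-b_t>0$ ($t\in S^-$), where $\sum_{s\in S^+}b_s+\sum_{t\in S^-}b_t=0$; put $b_v=0$ for all other nodes $v$. A transshipment over time with time horizon $\theta\ge 0$ consists of Lebesgue measurable inflow rates $f_a:[0,\theta-\tau_a)\to[0,u_a]$, $a\in A$, such that, with $\mathrm{ex}(v,\xi)$ denoting the total amount of flow that has arrived at $v$ until time $\xi$ minus the total amount that has left $v$ until time $\xi$, we have $\mathrm{ex}(v,\xi)\ge 0$ for all $v\in V\setminus S^+$ and $\xi\in[0,\theta]$, and $\mathrm{ex}(v,\theta)=-b_v$ for all $v\in V$. In the model without storage at intermediate nodes one requires in addition $\mathrm{ex}(v,\xi)=0$ for all $v\in V\setminus(S^+\cup S^-)$ and $\xi\in[0,\theta]$. The amount of flow on arc $a$ is $x_a=\int_0^{\theta-\tau_a}f_a(\xi)\,d\xi$ (an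 integral over an empty interval is $0$), and the cost of $f$ is $\sum_{a\in A}c_a x_a$. A transshipment over time has minimum cost if no transshipment over time (in the same model, with any time horizon) has smaller cost. Let $\bar A$ be the set of all pairs $st\in S^+\times S^-$ for which $D$ contains an $s$-$t$-path, and for $st\in\bar A$ let $\bar c_{st}$ be the minimum of $c(P)=\sum_{a\in P}c_a$ over all (simple) $s$-$t$-paths $P$. Let $y^*$ be an optimal solution of the linear program $$\max\ \sum_{s\in S^+}b_sy_s+\sum_{t\in S^-}b_ty_t\quad\text{s.t.}\quad y_s-y_t\le\bar c_{st}\ \text{ for all } st\in\bar A,$$ the dual of the transportation problem on $(S^+\cup S^-,\bar A)$ with costs $\bar c$ and supplies and demands $b$. For $s\in S^+$ and $t\in S^-$, an $s$-$t$-path $P$ in $D$ is called admissible if $st\in\bar A$, $y^*_s-y^*_t=\bar c_{st}$ and $c(P)=\bar c_{st}$. A decomposition of a transshipment over time $f$ assigns positive amounts of flow to finitely many paths from sources to sinks and to finitely many directed cycles such that, for every arc $a$, the amounts on the paths and cycles that contain $a$ add up to $x_a$. Then, in the model with storage as well as in the model without storage, the following are equivalent for every transshipment over time $f$ in $D$: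 1. $f$ has minimum cost; 2. $f$ sends flow from sources $s\in S^+$ to sinks $t\in S^-$ along admissible $s$-$t$-paths only, apart from flow along cycles of zero cost, in the following sense: in some decomposition of $f$, all paths are admissible and all cycles have zero cost; 3. the same holds in every decomposition of $f$. -/

import Mathlib

open MeasureTheory

noncomputable section

namespace FlowsOverTime

/-- A finite directed network (parallel arcs and loops are allowed) with capacities, transit times
and costs on the arcs, and with sources and sinks that have supplies and demands. -/
structure Network (V A : Type*) [Fintype V] [DecidableEq V] [Fintype A] [DecidableEq A] where
  tail : A → V
  head : A → V
  capacity : A → ℝ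
  transit : A → ℝ
  cost : A → ℝ
  sources : Finset V
  sinks : Finset V
  /-- `b s > 0` is the supply of a source `s`, and `-b t > 0` is the demand of a sink `t`. -/
  b : V → ℝ
  capacity_pos : ∀ a, 0 < capacity a
  transit_nonneg : ∀ a, 0 ≤ transit a
  disjoint_terminals : Disjoint sources sinks
  supply_pos : ∀ s ∈ sources, 0 < b s
  demand_pos : ∀ t ∈ sinks, 0 < -b t
  b_eq_zero : ∀ v, v ∉ sources → v ∉ sinks → b v = 0
  balanced : ∑ s ∈ sources, b s + ∑ t ∈ sinks, b t = 0

namespace Network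

variable {V A : Type*} [Fintype V] [DecidableEq V] [Fintype A] [DecidableEq A]

/-! ### Paths and cycles -/

/-- The list of arcs `p` forms a directed walk from `v` to `w`. -/
def IsWalk (N : Network V A) : V → List A → V → Prop
  | v, [], w => v = w
  | v, a :: p, w => N.tail a = v ∧ N.IsWalk (N.head a) p w

/-- A directed path from `s` to `t`: a walk without repeated nodes. -/
def IsPath (N : Network V A) (s : V) (p : List A) (t : V) : Prop :=
  N.IsWalk s p t ∧ (s :: p.map N.head).Nodup

/-- A directed cycle: a nonempty closed walk that repeats no node except for its end point. -/
def IsCycle (N : Network V A) (p : List A) : Prop :=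
  p ≠ [] ∧ (∃ v, N.IsWalk v p v) ∧ (p.map N.head).Nodup

/-- The total cost `c(P)` of a list of arcs. -/
def pathCost (N : Network V A) (p : List A) : ℝ :=
  (p.map N.cost).sum

/-- Arc costs are conservative: there is no negative cost cycle. -/
def Conservative (N : Network V A) : Prop :=
  ∀ p, N.IsCycle p → 0 ≤ N.pathCost p

/-! ### Transshipments over time -/

/-- The amount of flow in node `v` at time `ξ`, for inflow rates `f` and time horizon `θ`: the
inflow into `v` until time `ξ` minus the outflow out of `v` until time `ξ`. Flow enters an arc `a`
only during `[0, θ - τ a)` and leaves it `τ a` time units after it has entered. -/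
def excess (N : Network V A) (θ : ℝ) (f : A → ℝ → ℝ) (v : V) (ξ : ℝ) : ℝ :=
  (∑ a with N.head a = v, ∫ x in Set.Ico 0 (ξ - N.transit a), f a x) -
    (∑ a with N.tail a = v, ∫ x in Set.Ico 0 (min ξ (θ - N.transit a)), f a x)

/-- A transshipment over time. If `storage` is `true`, then flow may be stored temporarily at
intermediate nodes; if `storage` is `false`, then this is forbidden. Only the values of `rate a`
on `[0, θ - τ a)`, where `θ` is the time horizon, matter. -/
structure Transshipment (N : Network V A) (storage : Bool) where
  horizon : ℝ
  rate : A → ℝ → ℝ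
  horizon_nonneg : 0 ≤ horizon
  measurable : ∀ a,
    AEMeasurable (rate a) (volume.restrict (Set.Ico 0 (horizon - N.transit a)))
  nonneg : ∀ a, ∀ x ∈ Set.Ico 0 (horizon - N.transit a), 0 ≤ rate a x
  le_capacity : ∀ a, ∀ x ∈ Set.Ico 0 (horizon - N.transit a), rate a x ≤ N.capacity a
  /-- No flow deficit occurs at any time, except at sources. -/
  no_deficit : ∀ v ∉ N.sources, ∀ ξ ∈ Set.Icc 0 horizon, 0 ≤ N.excess horizon rate v ξ
  no_storage : storage = false → ∀ v ∉ N.sources, v ∉ N.sinks →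
    ∀ ξ ∈ Set.Icc 0 horizon, N.excess horizon rate v ξ = 0
  /-- At the time horizon all supplies have been sent, all demands are satisfied, and no flow
  remains at intermediate nodes. -/
  satisfies : ∀ v, N.excess horizon rate v horizon = -N.b v

/-- The total amount of flow that enters and traverses arc `a`. -/
def Transshipment.amount {N : Network V A} {storage : Bool} (f : N.Transshipment storage)
    (a : A) : ℝ :=
  ∫ x in Set.Ico 0 (f.horizon - N.transit a), f.rate a x

def Transshipment.cost {N : Network V A} {storage : Bool} (f : N.Transshipment storage) : ℝ :=
  ∑ a, N.cost a * f.amount a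

/-- `f` has minimum cost among all transshipments over time, with arbitrary time horizons. -/
def Transshipment.IsMinCost {N : Network V A} {storage : Bool}
    (f : N.Transshipment storage) : Prop :=
  ∀ g : N.Transshipment storage, f.cost ≤ g.cost

/-! ### The static transportation problem and its dual -/

/-- There is an arc `st` in the bipartite network (`s` a source and `t` a sink): the sink `t` can
be reached from the source `s` along a path. -/
def IsBarArc (N : Network V A) (s t : V) : Prop :=
  s ∈ N.sources ∧ t ∈ N.sinks ∧ ∃ p, N.IsPath s p t

/-- The cost of a cheapest `s`-`t`-path; a minimum over finitely many paths. -/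
def barCost (N : Network V A) (s t : V) : ℝ :=
  sInf {r | ∃ p, N.IsPath s p t ∧ N.pathCost p = r}

/-- The infimum in `barCost` is attained as soon as there is an `s`-`t`-path. -/
theorem barCost_isLeast (N : Network V A) {s t : V} (h : ∃ p, N.IsPath s p t) :
    IsLeast {r | ∃ p, N.IsPath s p t ∧ N.pathCost p = r} (N.barCost s t) := by
  have hfin : {p : List A | p.length ≤ Fintype.card V}.Finite := List.finite_length_le A _
  have hfin2 : {r | ∃ p, N.IsPath s p t ∧ N.pathCost p = r}.Finite := by
    refine (hfin.image N.pathCost).subset ?_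
    rintro r ⟨p, hp, rfl⟩
    refine ⟨p, ?_, rfl⟩
    have := hp.2.length_le_card
    simp only [List.length_cons, List.length_map] at this
    change p.length ≤ Fintype.card V
    omega
  obtain ⟨p, hp⟩ := h
  have hne : {r | ∃ p, N.IsPath s p t ∧ N.pathCost p = r}.Nonempty := ⟨_, p, hp, rfl⟩
  exact ⟨hne.csInf_mem hfin2, fun r hr => csInf_le hfin2.bddBelow hr⟩

/-- Feasibility for the dual of the transportation problem. -/
def DualFeasible (N : Network V A) (y : V → ℝ) : Prop :=
  ∀ s t, N.IsBarArc s t → y s - y t ≤ N.barCost s t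

def dualObjective (N : Network V A) (y : V → ℝ) : ℝ :=
  ∑ s ∈ N.sources, N.b s * y s + ∑ t ∈ N.sinks, N.b t * y t

/-- `y` is an optimal solution of the dual of the transportation problem. -/
def DualOptimal (N : Network V A) (y : V → ℝ) : Prop :=
  N.DualFeasible y ∧ ∀ z, N.DualFeasible z → N.dualObjective z ≤ N.dualObjective y

/-- The pair `s, t` is active: `st` is an arc of the bipartite network whose dual constraint
is tight. -/
def Active (N : Network V A) (y : V → ℝ) (s t : V) : Prop :=
  N.IsBarArc s t ∧ y s - y t = N.barCost s t

/-- `p` is an admissible `s`-`t`-path: `s, t` is active and `p` is a cheapest `s`-`t`-path. -/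
def Admissible (N : Network V A) (y : V → ℝ) (s : V) (p : List A) (t : V) : Prop :=
  N.Active y s t ∧ N.IsPath s p t ∧ N.pathCost p = N.barCost s t

/-! ### The paths along which flow is sent -/

/-- A decomposition of the flow of a transshipment over time: finitely many source-sink-paths and
finitely many cycles, together with the amounts of flow that are sent along them, which add up to
the amount of flow on every arc. A path or cycle carries a positive amount of flow if and only if it
is in the support. -/
structure Transshipment.Decomposition {N : Network V A} {storage : Bool}
    (f : N.Transshipment storage) where
  onPath : List A →₀ ℝ
  onCycle : List A →₀ ℝ
  onPath_nonneg : ∀ p, 0 ≤ onPath p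
  onCycle_nonneg : ∀ p, 0 ≤ onCycle p
  isPath : ∀ p ∈ onPath.support, ∃ s ∈ N.sources, ∃ t ∈ N.sinks, N.IsPath s p t
  isCycle : ∀ p ∈ onCycle.support, N.IsCycle p
  amount_eq : ∀ a, f.amount a =
    (onPath.sum fun p r => r * (p.count a : ℝ)) + onCycle.sum fun p r => r * (p.count a : ℝ)

/-- Along source-sink-paths flow is sent only if they are admissible, and there is no other flow
except possibly for flow along cycles of zero cost. -/
def Transshipment.Decomposition.OnlyAdmissible {N : Network V A} {storage : Bool}
    {f : N.Transshipment storage} (d : f.Decomposition) (y : V → ℝ) : Prop :=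
  (∀ p ∈ d.onPath.support, ∀ s ∈ N.sources, ∀ t ∈ N.sinks,
      N.IsPath s p t → N.Admissible y s p t) ∧
    ∀ p ∈ d.onCycle.support, N.pathCost p = 0

end Network

end FlowsOverTime

end

open MeasureTheory
noncomputable section
namespace FlowsOverTime
namespace Network
variable {V A : Type*} [Fintype V] [DecidableEq V] [Fintype A] [DecidableEq A]

/-! ### Walks, paths and potentials -/

/-! Integrating the rates turns `f` into a static flow with net outflow `b` (`isFlow_amount`). For
any decomposition, telescoping potentials express the gap `f.cost - N.dualObjective y` as the sum of
`c(P) - (y_s - y_t)` over paths and `c(C)` over cycles, weighted by their flow amounts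
(`cost_sub_dualObjective`). Dual feasibility and the absence of negative cycles make every term
nonnegative, so the gap vanishes iff all paths are admissible and all cycles have zero cost. This
criterion does not depend on the decomposition, and a decomposition exists
(`nonempty_decomposition`), so "some" and "every" agree.

It remains to attain the dual value (`DualOptimal.exists_cost_eq`). A Farkas argument gives a
transportation plan supported on active pairs. As the horizon is free, the plan is realised over
time by sending along cheapest paths at a small constant rate. Flow sent this way never waits at an
interior node, so one construction serves both storage models. -/

theorem IsWalk.sum_potential {N : Network V A} (φ : V → ℝ) {p : List A} {v w : V}
    (h : N.IsWalk v p w) :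
    (p.map fun a => φ (N.tail a) - φ (N.head a)).sum = φ v - φ w := by
  induction p generalizing v with
  | nil => cases h; simp
  | cons a p ih =>
    obtain ⟨rfl, h⟩ := h
    simp [ih h]

theorem sum_mul_count (c : A → ℝ) (p : List A) :
    ∑ a, c a * (p.count a : ℝ) = (p.map c).sum := by
  induction p with
  | nil => simp
  | cons e p ih =>
    simp only [List.count_cons, Nat.cast_add, mul_add, Finset.sum_add_distrib, ih, List.map_cons,
      List.sum_cons]
    rw [add_comm]
    simp

theorem IsPath.exists_suffix {N : Network V A} {p : List A} {u v w : V} (h : N.IsPath u p w)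
    (hv : v ∈ u :: p.map N.head) : ∃ q, q <:+ p ∧ N.IsPath v q w := by
  induction p generalizing u with
  | nil =>
    obtain rfl : v = u := by simpa using hv
    exact ⟨[], List.suffix_rfl, h⟩
  | cons a p ih =>
    rcases List.mem_cons.1 hv with rfl | hv
    · exact ⟨_, List.suffix_rfl, h⟩
    · obtain ⟨q, hq, hq'⟩ := ih ⟨h.1.2, (List.nodup_cons.1 h.2).2⟩ hv
      exact ⟨q, hq.trans (List.suffix_cons a p), hq'⟩

/-- Nodes that are connected by arcs with property `Q` are connected by a path of such arcs. -/
theorem exists_isPath_of_reflTransGen {N : Network V A} {Q : A → Prop} {v w : V}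
    (h : Relation.ReflTransGen (fun u u' => ∃ a, Q a ∧ N.tail a = u ∧ N.head a = u') v w) :
    ∃ p, N.IsPath v p w ∧ ∀ a ∈ p, Q a := by
  induction h using Relation.ReflTransGen.head_induction_on with
  | refl => exact ⟨[], ⟨rfl, by simp⟩, by simp⟩
  | head h _ ih =>
    obtain ⟨a, ha, rfl, rfl⟩ := h
    obtain ⟨p, hp, hpQ⟩ := ih
    -- If the new start node already lies on the path, the detour is cut off.
    by_cases hv : N.tail a ∈ N.head a :: p.map N.head
    · obtain ⟨q, hq, hq'⟩ := hp.exists_suffix hv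
      exact ⟨q, hq', fun e he => hpQ e (hq.subset he)⟩
    · refine ⟨a :: p, ⟨⟨rfl, hp.1⟩, List.nodup_cons.2 ⟨hv, hp.2⟩⟩, ?_⟩
      simpa [ha] using hpQ

/-! ### Static flows and their decomposition -/

/-- The static flow `x` has net outflow `b`, tested against node potentials. -/
def IsFlow (N : Network V A) (x : A → ℝ) (b : V → ℝ) : Prop :=
  ∀ φ : V → ℝ, ∑ a, (φ (N.tail a) - φ (N.head a)) * x a = ∑ v, φ v * b v

theorem IsFlow.of_net {N : Network V A} {x : A → ℝ} {b : V → ℝ}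
    (h : ∀ v, (∑ a with N.head a = v, x a) - (∑ a with N.tail a = v, x a) = -b v) :
    N.IsFlow x b := by
  intro φ
  have hb : ∀ v, b v = (∑ a with N.tail a = v, x a) - (∑ a with N.head a = v, x a) := fun v => by
    linarith [h v]
  have key : ∀ g : A → V, ∑ v, φ v * ∑ a with g a = v, x a = ∑ a, φ (g a) * x a := by
    intro g
    rw [← Finset.sum_fiberwise (s := Finset.univ) g]
    refine Finset.sum_congr rfl fun v _ => ?_
    rw [Finset.mul_sum]
    refine Finset.sum_congr rfl fun a ha => ?_
    rw [(Finset.mem_filter.1 ha).2]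
  simp only [hb, mul_sub, Finset.sum_sub_distrib, key, sub_mul]

/-- Subtracting flow along a walk. -/
theorem IsFlow.sub_walk {N : Network V A} {x : A → ℝ} {b : V → ℝ} (h : N.IsFlow x b)
    {p : List A} {v w : V} (hp : N.IsWalk v p w) (r : ℝ) :
    N.IsFlow (fun a => x a - r * (p.count a : ℝ))
      (fun u => b u - r * ((if u = v then 1 else 0) - if u = w then 1 else 0)) := by
  intro φ
  have h1 := sum_mul_count (fun a => φ (N.tail a) - φ (N.head a)) p
  rw [hp.sum_potential φ] at h1
  have h2 : ∑ a, (φ (N.tail a) - φ (N.head a)) * (x a - r * (p.count a : ℝ)) =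
      ∑ a, (φ (N.tail a) - φ (N.head a)) * x a -
        r * ∑ a, (φ (N.tail a) - φ (N.head a)) * (p.count a : ℝ) := by
    rw [Finset.mul_sum, ← Finset.sum_sub_distrib]
    exact Finset.sum_congr rfl fun a _ => by ring
  have h3 : ∑ u, φ u * (b u - r * ((if u = v then 1 else 0) - if u = w then 1 else 0)) =
      ∑ u, φ u * b u - r * (∑ u, φ u * (if u = v then 1 else 0) -
        ∑ u, φ u * (if u = w then 1 else 0)) := by
    rw [← Finset.sum_sub_distrib, Finset.mul_sum, ← Finset.sum_sub_distrib]
    exact Finset.sum_congr rfl fun a _ => by ring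
  rw [h2, h1, h3, h φ]
  simp

/-- The nodes reachable from `v` along arcs that carry flow. -/
def FlowReachable (N : Network V A) (x : A → ℝ) (v w : V) : Prop :=
  Relation.ReflTransGen (fun u u' => ∃ a, 0 < x a ∧ N.tail a = u ∧ N.head a = u') v w

theorem FlowReachable.head_of_tail {N : Network V A} {x : A → ℝ} {v : V} {a : A} (ha : 0 < x a)
    (h : N.FlowReachable x v (N.tail a)) : N.FlowReachable x v (N.head a) :=
  Relation.ReflTransGen.tail h ⟨a, ha, rfl, rfl⟩

-- Test against the indicator of the reachable set: no arc carrying flow leaves this set, so its net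
-- outflow is minus the inflow. The first part finds a sink for a given source, the strict part
-- finds cycles once `b = 0`.
open Classical in
theorem IsFlow.sum_reachable {N : Network V A} {x : A → ℝ} {b : V → ℝ} (h : N.IsFlow x b)
    (hx : ∀ a, 0 ≤ x a) (v : V) :
    (∑ w with N.FlowReachable x v w, b w) ≤ 0 ∧
      ∀ a, 0 < x a → N.FlowReachable x v (N.head a) → ¬ N.FlowReachable x v (N.tail a) →
        (∑ w with N.FlowReachable x v w, b w) < 0 := by
  have h1 := h (fun w => if N.FlowReachable x v w then 1 else 0)
  have h2 : ∑ w, (if N.FlowReachable x v w then (1 : ℝ) else 0) * b w =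
      ∑ w with N.FlowReachable x v w, b w := by
    rw [Finset.sum_filter]
    exact Finset.sum_congr rfl fun w _ => by split_ifs <;> simp
  rw [h2] at h1
  have hle : ∀ a ∈ Finset.univ, ((if N.FlowReachable x v (N.tail a) then (1 : ℝ) else 0) -
      if N.FlowReachable x v (N.head a) then 1 else 0) * x a ≤ 0 := by
    intro a _
    rcases (hx a).eq_or_lt with h0 | h0
    · simp [← h0]
    · have := FlowReachable.head_of_tail (N := N) (v := v) h0
      split_ifs <;> simp_all [le_of_lt]
  rw [← h1]
  refine ⟨Finset.sum_nonpos hle, fun a ha hh ht => ?_⟩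
  refine Finset.sum_neg' hle ⟨a, Finset.mem_univ _, ?_⟩
  simp [hh, ht, ha]

theorem exists_mem_le_of_ne_nil {l : List ℝ} (h : l ≠ []) : ∃ m ∈ l, ∀ r ∈ l, m ≤ r := by
  obtain ⟨m, hm, hm'⟩ := l.toFinset.exists_min_image id
    ((List.toFinset_nonempty_iff l).2 h)
  exact ⟨m, by simpa using hm, fun r hr => hm' r (by simpa using hr)⟩

theorem nodup_of_map_nodup {N : Network V A} {p : List A} (h : (p.map N.head).Nodup) :
    p.Nodup := List.Nodup.of_map _ h

/-- The amount that is subtracted from a flow along a path or a cycle is at most the flow value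
on each arc. -/
theorem sub_count_nonneg {α : Type*} [DecidableEq α] {x : α → ℝ} (hx : ∀ a, 0 ≤ x a) {p : List α}
    (hp : p.Nodup) {r : ℝ} (hr : ∀ a ∈ p, r ≤ x a) (a : α) : 0 ≤ x a - r * (p.count a : ℝ) := by
  by_cases ha : a ∈ p
  · simp [List.count_eq_one_of_mem hp ha, hr a ha]
  · simp [List.count_eq_zero_of_not_mem ha, hx a]

theorem support_sub_count {α : Type*} [DecidableEq α] {x : α → ℝ} {p : List α}
    (hp : ∀ a ∈ p, 0 < x a) {r : ℝ} (a : α)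
    (ha : x a - r * (p.count a : ℝ) ≠ 0) : x a ≠ 0 := by
  by_cases h : a ∈ p
  · exact (hp a h).ne'
  · simpa [List.count_eq_zero_of_not_mem h] using ha

theorem sum_add_single_mul_count {α : Type*} [DecidableEq α] (P : List α →₀ ℝ) (p : List α)
    (r : ℝ) (a : α) :
    ((P + Finsupp.single p r).sum fun q k => k * (q.count a : ℝ)) =
      (P.sum fun q k => k * (q.count a : ℝ)) + r * (p.count a : ℝ) := by
  rw [Finsupp.sum_add_index' (by simp) (by intros; ring), Finsupp.sum_single_index (by simp)]

/-- Flow decomposition: a nonnegative static flow is a conic combination of source-sink-paths and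
cycles. -/
theorem IsFlow.exists_decomposition {N : Network V A} (n : ℕ) {x : A → ℝ} {b : V → ℝ}
    (h : N.IsFlow x b) (hx : ∀ a, 0 ≤ x a) (hs : ∀ v, 0 < b v → v ∈ N.sources)
    (ht : ∀ v, b v < 0 → v ∈ N.sinks)
    (hn : (Finset.univ.filter fun a => x a ≠ 0).card +
      (Finset.univ.filter fun v => b v ≠ 0).card ≤ n) :
    ∃ P C : List A →₀ ℝ, (∀ p, 0 ≤ P p) ∧ (∀ p, 0 ≤ C p) ∧
      (∀ p ∈ P.support, ∃ s ∈ N.sources, ∃ t ∈ N.sinks, N.IsPath s p t) ∧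
      (∀ p ∈ C.support, N.IsCycle p) ∧
      ∀ a, x a = (P.sum fun p r => r * (p.count a : ℝ)) + C.sum fun p r => r * (p.count a : ℝ) := by
  classical
  -- The measure counts arcs carrying flow plus unbalanced nodes. Each subtraction makes at least
  -- one of these vanish and creates none.
  induction n generalizing x b with
  | zero =>
    have hx0 : ∀ a, x a = 0 := by
      have : (Finset.univ.filter fun a => x a ≠ 0) = ∅ := by
        rw [← Finset.card_eq_zero]; omega
      simpa [Finset.filter_eq_empty_iff] using this
    exact ⟨0, 0, by simp, by simp, by simp, by simp, by simp [hx0]⟩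
  | succ n ih =>
    by_cases hpos : ∃ v, 0 < b v
    · obtain ⟨s, hs0⟩ := hpos
      obtain ⟨t, hst, ht0⟩ : ∃ t, N.FlowReachable x s t ∧ b t < 0 := by
        by_contra! hcon
        have h1 := (h.sum_reachable hx s).1
        have h2 : 0 < ∑ w with N.FlowReachable x s w, b w :=
          Finset.sum_pos' (fun w hw => hcon w (Finset.mem_filter.1 hw).2)
            ⟨s, Finset.mem_filter.2 ⟨Finset.mem_univ _, Relation.ReflTransGen.refl⟩, hs0⟩
        linarith
      obtain ⟨p, hp, hpx⟩ := exists_isPath_of_reflTransGen hst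
      have hne : s ≠ t := by rintro rfl; linarith
      have hpn : p.Nodup := nodup_of_map_nodup (List.nodup_cons.1 hp.2).2
      -- The bottleneck: whichever of `b s`, `-b t` or the arc flows attains the minimum drops to
      -- zero, and no sign flips.
      obtain ⟨r, hr, hr'⟩ := exists_mem_le_of_ne_nil (l := b s :: -b t :: p.map x) (by simp)
      have hrp : ∀ a ∈ p, r ≤ x a := fun a ha => hr' _ (by simp; exact .inr (.inr ⟨a, ha, rfl⟩))
      have hrs : r ≤ b s := hr' _ (by simp)
      have hrt : r ≤ -b t := hr' _ (by simp)
      have hr0 : 0 < r := by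
        simp only [List.mem_cons, List.mem_map] at hr
        rcases hr with rfl | rfl | ⟨a, ha, rfl⟩
        · exact hs0
        · linarith
        · exact hpx a ha
      have hbs : ∀ u, b u - r * ((if u = s then 1 else 0) - if u = t then 1 else 0) =
          if u = s then b s - r else if u = t then b t + r else b u := by
        intro u
        by_cases h1 : u = s
        · subst h1; simp [hne]
        · by_cases h2 : u = t
          · subst h2; simp [h1]
          · simp [h1, h2]
      have hf := h.sub_walk hp.1 r
      simp only [hbs] at hf
      obtain ⟨P, C, hP, hC, hP', hC', hPC⟩ := ih hf (sub_count_nonneg hx hpn hrp)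
        (by
          intro u hu
          refine hs u ?_
          split_ifs at hu with h1 h2
          · rw [h1]; exact hs0
          · linarith
          · exact hu)
        (by
          intro u hu
          refine ht u ?_
          split_ifs at hu with h1 h2
          · linarith
          · rw [h2]; exact ht0
          · exact hu)
        (by
          have hsub1 : (Finset.univ.filter fun a => x a - r * (p.count a : ℝ) ≠ 0) ⊆
              Finset.univ.filter fun a => x a ≠ 0 :=
            Finset.monotone_filter_right _ fun a _ => support_sub_count hpx a
          have hsub2 : (Finset.univ.filter fun u =>
              (if u = s then b s - r else if u = t then b t + r else b u) ≠ 0) ⊆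
              Finset.univ.filter fun u => b u ≠ 0 := by
            refine Finset.monotone_filter_right _ fun u _ hu => ?_
            split_ifs at hu with h1 h2
            · rw [h1]; exact hs0.ne'
            · rw [h2]; exact ht0.ne
            · exact hu
          have hc1 := Finset.card_le_card hsub1
          have hc2 := Finset.card_le_card hsub2
          simp only [List.mem_cons, List.mem_map] at hr
          have hlt : (Finset.univ.filter fun a => x a - r * (p.count a : ℝ) ≠ 0).card <
              (Finset.univ.filter fun a => x a ≠ 0).card ∨ (Finset.univ.filter fun u =>
              (if u = s then b s - r else if u = t then b t + r else b u) ≠ 0).card <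
              (Finset.univ.filter fun u => b u ≠ 0).card := by
            rcases hr with h1 | h1 | ⟨a, ha, h1⟩
            · refine .inr (Finset.card_lt_card
                (Finset.ssubset_iff_subset_ne.2 ⟨hsub2, fun he => ?_⟩))
              have : s ∈ Finset.univ.filter fun u => b u ≠ 0 := by simp [hs0.ne']
              rw [← he] at this
              simp [h1] at this
            · refine .inr (Finset.card_lt_card
                (Finset.ssubset_iff_subset_ne.2 ⟨hsub2, fun he => ?_⟩))
              have : t ∈ Finset.univ.filter fun u => b u ≠ 0 := by simp [ht0.ne]
              rw [← he] at this
              simp [h1, hne.symm] at this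
            · refine .inl (Finset.card_lt_card
                (Finset.ssubset_iff_subset_ne.2 ⟨hsub1, fun he => ?_⟩))
              have : a ∈ Finset.univ.filter fun a => x a ≠ 0 := by simp [(hpx a ha).ne']
              rw [← he] at this
              simp [h1, List.count_eq_one_of_mem hpn ha] at this
          omega)
      refine ⟨P + Finsupp.single p r, C, fun q => ?_, hC, fun q hq => ?_, hC', fun a => ?_⟩
      · rw [Finsupp.add_apply]
        refine add_nonneg (hP q) ?_
        rw [Finsupp.single_apply]; split_ifs <;> simp [hr0.le]
      · rcases Finset.mem_union.1 (Finsupp.support_add hq) with hq | hq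
        · exact hP' q hq
        · obtain rfl : q = p := by simpa using Finsupp.support_single_subset hq
          exact ⟨s, hs s hs0, t, ht t ht0, hp⟩
      · rw [sum_add_single_mul_count]
        linarith [hPC a]
    · push Not at hpos
      -- The balances sum to zero (constant potential) and none is positive, so `x` is a
      -- circulation.
      have hb0 : ∀ v, b v = 0 := by
        have h1 := h (fun _ => 1)
        simp only [sub_self, zero_mul, Finset.sum_const_zero, one_mul] at h1
        have h2 := (Finset.sum_eq_zero_iff_of_nonpos fun v _ => hpos v).1 h1.symm
        exact fun v => h2 v (Finset.mem_univ v)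
      by_cases hx0 : ∀ a, x a = 0
      · exact ⟨0, 0, by simp, by simp, by simp, by simp, by simp [hx0]⟩
      push Not at hx0
      obtain ⟨e, he⟩ := hx0
      have he : 0 < x e := lt_of_le_of_ne (hx e) he.symm
      have hreach : N.FlowReachable x (N.head e) (N.tail e) := by
        by_contra hcon
        have := (h.sum_reachable hx (N.head e)).2 e he Relation.ReflTransGen.refl hcon
        simp [hb0] at this
      obtain ⟨q, hq, hqx⟩ := exists_isPath_of_reflTransGen hreach
      -- The heads of `e :: q` are exactly the nodes of the path `q`, hence distinct.
      obtain ⟨p, hp, hpc, hpx⟩ : ∃ p, N.IsWalk (N.tail e) p (N.tail e) ∧ N.IsCycle p ∧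
          ∀ a ∈ p, 0 < x a :=
        ⟨e :: q, ⟨rfl, hq.1⟩, ⟨by simp, ⟨_, rfl, hq.1⟩, hq.2⟩, by simpa [he] using hqx⟩
      have hpn : p.Nodup := nodup_of_map_nodup hpc.2.2
      obtain ⟨r, hr, hr'⟩ := exists_mem_le_of_ne_nil (l := p.map x) (by simpa using hpc.1)
      obtain ⟨a, ha, rfl⟩ := List.mem_map.1 hr
      have hrp : ∀ a' ∈ p, x a ≤ x a' := fun a' h' => hr' _ (List.mem_map_of_mem h')
      have hf := h.sub_walk hp (x a)
      simp only [sub_self, mul_zero, sub_zero] at hf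
      obtain ⟨P, C, hP, hC, hP', hC', hPC⟩ := ih hf (sub_count_nonneg hx hpn hrp) hs ht
        (by
          have hlt : (Finset.univ.filter fun a' => x a' - x a * (p.count a' : ℝ) ≠ 0).card <
              (Finset.univ.filter fun a => x a ≠ 0).card := by
            refine Finset.card_lt_card (Finset.ssubset_iff_subset_ne.2
              ⟨Finset.monotone_filter_right _ fun a' _ => support_sub_count hpx a',
                fun he => ?_⟩)
            have : a ∈ Finset.univ.filter fun a => x a ≠ 0 := by simp [(hpx a ha).ne']
            rw [← he] at this
            simp [List.count_eq_one_of_mem hpn ha] at this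
          omega)
      refine ⟨P, C + Finsupp.single p (x a), hP, fun q => ?_, hP', fun q hq => ?_, fun a' => ?_⟩
      · rw [Finsupp.add_apply]
        refine add_nonneg (hC q) ?_
        rw [Finsupp.single_apply]; split_ifs <;> simp [hx a]
      · rcases Finset.mem_union.1 (Finsupp.support_add hq) with hq | hq
        · exact hC' q hq
        · obtain rfl : q = p := by simpa using Finsupp.support_single_subset hq
          exact hpc
      · rw [sum_add_single_mul_count]
        linarith [hPC a']

/-! ### The transportation problem -/

/-- First-order optimality: for small `ε` the linear term dominates. With `ε ≤ p / (|q| + 1)` the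
quadratic term is at most `ε * p`. -/
theorem nonpos_of_quadratic_nonneg {p q δ : ℝ} (hδ : 0 < δ)
    (h : ∀ ε, 0 < ε → ε ≤ δ → 0 ≤ -(2 * ε * p) + ε ^ 2 * q) : p ≤ 0 := by
  by_contra! hp
  have h1 : 0 < |q| + 1 := by positivity
  have hε : 0 < min δ (p / (|q| + 1)) := lt_min hδ (by positivity)
  have h2 := h _ hε (min_le_left _ _)
  have h3 : min δ (p / (|q| + 1)) * (|q| + 1) ≤ p := by
    rw [← le_div_iff₀ h1]; exact min_le_right _ _
  nlinarith [le_abs_self q, mul_le_mul_of_nonneg_left (le_abs_self q) hε.le,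
    mul_pos hε hp]

/-- A variant of Farkas' lemma: `b` lies in the cone spanned by the vectors `m i` if every `r` of
the form `r = b - ∑ i, z i • m i` that has nonpositive inner product with all `m i` has nonpositive
inner product with `b`; it is assumed that the coefficients `z` are bounded in a suitable sense. -/
theorem exists_conic_combination {ι κ : Type*} [Fintype ι] [Fintype κ] (m : ι → κ → ℝ)
    (b : κ → ℝ) (B : ℝ) (hB : 0 < B)
    (hbd : ∀ z : ι → ℝ, (∀ i, 0 ≤ z i) → ∀ i, B ≤ z i →
      ∑ v, (b v - ∑ j, z j * m j v) * m i v < 0)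
    (hdual : ∀ d : κ → ℝ, (∀ i, ∑ v, d v * m i v ≤ 0) → ∑ v, d v * b v ≤ 0) :
    ∃ z : ι → ℝ, (∀ i, 0 ≤ z i) ∧ ∀ v, ∑ i, z i * m i v = b v := by
  classical
  have hcont : Continuous fun z : ι → ℝ => ∑ v, (b v - ∑ j, z j * m j v) ^ 2 := by fun_prop
  -- Minimising the squared distance to `b` over a compact box avoids proving that the cone is
  -- closed; `hbd` handles the coordinates at the upper bound `B`.
  obtain ⟨z, hz, hmin⟩ := (isCompact_Icc (a := (0 : ι → ℝ)) (b := fun _ => B)).exists_isMinOn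
    ⟨0, le_rfl, fun _ => hB.le⟩ hcont.continuousOn
  set r : κ → ℝ := fun v => b v - ∑ j, z j * m j v with hr
  have hstep : ∀ i ε, z i + ε ∈ Set.Icc 0 B →
      0 ≤ -(2 * ε * ∑ v, r v * m i v) + ε ^ 2 * ∑ v, m i v ^ 2 := by
    intro i ε hε
    have hmem : Function.update z i (z i + ε) ∈ Set.Icc (0 : ι → ℝ) fun _ => B := by
      constructor <;> intro j <;> by_cases hj : j = i
      · subst hj; simpa using hε.1
      · simpa [hj] using hz.1 j
      · subst hj; simpa using hε.2
      · simpa [hj] using hz.2 j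
    have h1 : ∑ v, r v ^ 2 ≤ ∑ v, (b v - ∑ j, Function.update z i (z i + ε) j * m j v) ^ 2 :=
      hmin hmem
    have h2 : ∀ v, ∑ j, Function.update z i (z i + ε) j * m j v =
        ∑ j, z j * m j v + ε * m i v := by
      intro v
      rw [← Finset.add_sum_erase _ _ (Finset.mem_univ i),
        ← Finset.add_sum_erase _ (fun j => z j * m j v) (Finset.mem_univ i)]
      have : ∑ j ∈ Finset.univ.erase i, Function.update z i (z i + ε) j * m j v =
          ∑ j ∈ Finset.univ.erase i, z j * m j v :=
        Finset.sum_congr rfl fun j hj => by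
          rw [Function.update_of_ne (Finset.ne_of_mem_erase hj)]
      rw [this, Function.update_self]
      ring
    have h3 : ∑ v, (b v - ∑ j, Function.update z i (z i + ε) j * m j v) ^ 2 =
        ∑ v, r v ^ 2 + (-(2 * ε * ∑ v, r v * m i v) + ε ^ 2 * ∑ v, m i v ^ 2) := by
      simp only [h2, Finset.mul_sum, ← Finset.sum_neg_distrib, ← Finset.sum_add_distrib, hr]
      exact Finset.sum_congr rfl fun v _ => by ring
    linarith
  -- A positive coordinate can be decreased; for `hle`, a coordinate below `B` can be increased.
  have hge : ∀ i, 0 < z i → 0 ≤ ∑ v, r v * m i v := by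
    intro i hi
    have := nonpos_of_quadratic_nonneg (p := -∑ v, r v * m i v) (q := ∑ v, m i v ^ 2) hi
      fun ε hε hε' => by
        have h1 := hstep i (-ε) ⟨by linarith, by linarith [hz.2 i]⟩
        nlinarith
    linarith
  have hle : ∀ i, ∑ v, r v * m i v ≤ 0 := by
    intro i
    rcases lt_or_ge (z i) B with hi | hi
    · exact nonpos_of_quadratic_nonneg (q := ∑ v, m i v ^ 2) (sub_pos.2 hi) fun ε hε hε' =>
        hstep i ε ⟨add_nonneg (hz.1 i) hε.le, by linarith⟩
    · exact (hbd z hz.1 i hi).le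
  have horth : ∑ i, z i * ∑ v, r v * m i v = 0 := by
    refine Finset.sum_eq_zero fun i _ => ?_
    rcases (hz.1 i).eq_or_lt with h0 | h0
    · simp [← h0]
    · rw [le_antisymm (hle i) (hge i h0), mul_zero]
  -- By `horth` the last sum is zero, so `hdual` applied to `r` forces `r = 0`.
  have hrr : ∑ v, r v ^ 2 = ∑ v, r v * b v - ∑ i, z i * ∑ v, r v * m i v := by
    simp only [Finset.mul_sum]
    rw [Finset.sum_comm, ← Finset.sum_sub_distrib]
    refine Finset.sum_congr rfl fun v _ => ?_
    have : r v ^ 2 = r v * b v - r v * ∑ j, z j * m j v := by simp only [hr]; ring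
    rw [this, Finset.mul_sum]
    congr 1
    exact Finset.sum_congr rfl fun i _ => by ring
  have h0 : ∑ v, r v ^ 2 = 0 := le_antisymm (by linarith [hdual r hle])
    (Finset.sum_nonneg fun v _ => sq_nonneg _)
  refine ⟨z, hz.1, fun v => ?_⟩
  have h1 := (Finset.sum_eq_zero_iff_of_nonneg fun v _ => sq_nonneg (r v)).1 h0 v
    (Finset.mem_univ v)
  have h2 : r v = 0 := by simpa using h1
  simp only [hr] at h2
  linarith

theorem dualObjective_eq (N : Network V A) (y : V → ℝ) :
    N.dualObjective y = ∑ v, y v * N.b v := by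
  rw [dualObjective, ← Finset.sum_union N.disjoint_terminals,
    ← Finset.sum_subset (Finset.subset_univ (N.sources ∪ N.sinks))]
  · exact Finset.sum_congr rfl fun v _ => mul_comm _ _
  · intro v _ hv
    rw [Finset.mem_union, not_or] at hv
    rw [N.b_eq_zero v hv.1 hv.2, mul_zero]

/-- A direction that does not violate the tight constraints does not improve an optimal dual
solution. -/
theorem DualOptimal.direction_nonpos {N : Network V A} {y : V → ℝ} (hy : N.DualOptimal y)
    {d : V → ℝ} (hd : ∀ s t, N.Active y s t → d s - d t ≤ 0) : ∑ v, d v * N.b v ≤ 0 := by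
  -- Tight constraints survive by `hd`, slack ones by continuity; there are finitely many pairs, so
  -- one `ε` works for all.
  obtain ⟨ε, hε, hεd⟩ : ∃ ε > 0, ∀ st : V × V, N.IsBarArc st.1 st.2 →
      y st.1 - y st.2 + ε * (d st.1 - d st.2) ≤ N.barCost st.1 st.2 := by
    have hev : ∀ st : V × V, ∀ᶠ ε in nhdsWithin (0 : ℝ) (Set.Ioi 0), N.IsBarArc st.1 st.2 →
        y st.1 - y st.2 + ε * (d st.1 - d st.2) ≤ N.barCost st.1 st.2 := by
      rintro ⟨s, t⟩
      by_cases hbar : N.IsBarArc s t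
      swap
      · exact Filter.Eventually.of_forall fun ε h => absurd h hbar
      rcases (hy.1 s t hbar).eq_or_lt with h | h
      · filter_upwards [self_mem_nhdsWithin] with ε hε _
        have := mul_nonpos_of_nonneg_of_nonpos (le_of_lt hε) (hd s t ⟨hbar, h⟩)
        linarith
      · have hc : Filter.Tendsto (fun ε : ℝ => y s - y t + ε * (d s - d t))
            (nhdsWithin 0 (Set.Ioi 0)) (nhds (y s - y t + 0 * (d s - d t))) :=
          (Continuous.tendsto (by fun_prop) _).mono_left nhdsWithin_le_nhds
        rw [zero_mul, add_zero] at hc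
        filter_upwards [hc.eventually_lt_const h] with ε hε _ using hε.le
    obtain ⟨ε, h1, h2⟩ := ((Filter.eventually_all.2 hev).and self_mem_nhdsWithin).exists
    exact ⟨ε, h2, h1⟩
  have h1 := hy.2 (fun v => y v + ε * d v) fun s t hst => by
    have := hεd (s, t) hst
    dsimp only at this
    linarith
  simp only [dualObjective_eq, add_mul, Finset.sum_add_distrib, mul_assoc] at h1
  rw [← Finset.mul_sum] at h1
  by_contra! hcon
  nlinarith [mul_pos hε hcon]

/-- By linear programming duality, some feasible solution of the transportation problem uses only
pairs whose dual constraint is tight. -/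
theorem DualOptimal.exists_transportation {N : Network V A} {y : V → ℝ} (hy : N.DualOptimal y) :
    ∃ z : {st : V × V // N.Active y st.1 st.2} → ℝ, (∀ i, 0 ≤ z i) ∧
      ∀ v, ∑ᶠ i, z i * ((if i.1.1 = v then 1 else 0) - if i.1.2 = v then 1 else 0) = N.b v := by
  classical
  let m : {st : V × V // N.Active y st.1 st.2} → V → ℝ := fun i v =>
    (if i.1.1 = v then 1 else 0) - if i.1.2 = v then 1 else 0
  have hm : ∀ (d : V → ℝ) i, ∑ v, d v * m i v = d i.1.1 - d i.1.2 := by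
    intro d i
    simp [m, mul_sub, Finset.sum_sub_distrib]
  have hne : ∀ v : V, v ∈ N.sources → v ∉ N.sinks := fun v h1 h2 =>
    Finset.disjoint_left.1 N.disjoint_terminals h1 h2
  -- All terms at a source are nonnegative and all at a sink nonpositive. So the residual difference
  -- along pair `i` is at most `b_s - b_t - z i`, which is negative by the choice of the bound.
  have hbd : ∀ z : {st : V × V // N.Active y st.1 st.2} → ℝ, (∀ i, 0 ≤ z i) →
      ∀ i, 1 + 2 * ∑ v, |N.b v| ≤ z i → ∑ v, (N.b v - ∑ j, z j * m j v) * m i v < 0 := by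
    intro z hz i hi
    rw [hm (fun v => N.b v - ∑ j, z j * m j v)]
    have habs : ∀ v, |N.b v| ≤ ∑ v, |N.b v| := fun v =>
      Finset.single_le_sum (fun w _ => abs_nonneg (N.b w)) (Finset.mem_univ v)
    have hs : z i ≤ ∑ j, z j * m j i.1.1 := by
      have h1 : z i = z i * m i i.1.1 := by
        have : i.1.2 ≠ i.1.1 := fun h => hne _ i.2.1.1 (h ▸ i.2.1.2.1)
        simp [m, this]
      rw [h1]
      refine Finset.single_le_sum (f := fun j => z j * m j i.1.1) (fun j _ => ?_)
        (Finset.mem_univ i)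
      have : j.1.2 ≠ i.1.1 := fun h => hne _ i.2.1.1 (h ▸ j.2.1.2.1)
      refine mul_nonneg (hz j) ?_
      simp only [m, this, if_false, sub_zero]
      split_ifs <;> norm_num
    have ht : ∑ j, z j * m j i.1.2 ≤ 0 := by
      refine Finset.sum_nonpos fun j _ => ?_
      have : j.1.1 ≠ i.1.2 := fun h => hne _ j.2.1.1 (h ▸ i.2.1.2.1)
      refine mul_nonpos_of_nonneg_of_nonpos (hz j) ?_
      simp only [m, this, if_false, zero_sub]
      split_ifs <;> norm_num
    have hb1 := le_abs_self (N.b i.1.1)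
    have hb3 := neg_abs_le (N.b i.1.2)
    linarith [habs i.1.1, habs i.1.2]
  obtain ⟨z, hz, hzb⟩ := exists_conic_combination m N.b (1 + 2 * ∑ v, |N.b v|)
    (by positivity) hbd fun d hd => hy.direction_nonpos fun s t hst => by
      have := hd ⟨(s, t), hst⟩
      rwa [hm] at this
  refine ⟨z, hz, fun v => ?_⟩
  rw [finsum_eq_sum_of_fintype]
  exact hzb v

/-! ### Sending flow along walks at a constant rate -/

/-- The inflow rates if one unit of flow per time is sent along the arcs of `p`, starting to enter
the first arc at time `o`, for a time interval of length `T`. -/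
def walkRate (N : Network V A) (T : ℝ) : ℝ → List A → A → ℝ → ℝ
  | _, [], _, _ => 0
  | o, e :: p, a, x => (if a = e then (Set.Ico o (o + T)).indicator 1 x else 0) +
      N.walkRate T (o + N.transit e) p a x

theorem walkRate_nonneg (N : Network V A) (T o : ℝ) (p : List A) (a : A) (x : ℝ) :
    0 ≤ N.walkRate T o p a x := by
  induction p generalizing o with
  | nil => exact le_rfl
  | cons e p ih =>
    refine add_nonneg ?_ (ih _)
    split_ifs
    · exact Set.indicator_nonneg (fun _ _ => zero_le_one) _
    · exact le_rfl

/-- A crude bound, as a walk may repeat arcs; it gives integrability and fixes how slowly to send.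
-/
theorem walkRate_le_length (N : Network V A) (T o : ℝ) (p : List A) (a : A) (x : ℝ) :
    N.walkRate T o p a x ≤ p.length := by
  induction p generalizing o with
  | nil => simp [walkRate]
  | cons e p ih =>
    have h : (if a = e then (Set.Ico o (o + T)).indicator 1 x else 0) ≤ (1 : ℝ) := by
      split_ifs
      · exact Set.indicator_apply_le' (fun _ => le_rfl) fun _ => zero_le_one
      · exact zero_le_one
    simp only [walkRate, List.length_cons, Nat.cast_add, Nat.cast_one]
    linarith [ih (o + N.transit e)]

theorem measurable_walkRate (N : Network V A) (T o : ℝ) (p : List A) (a : A) :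
    Measurable (N.walkRate T o p a) := by
  induction p generalizing o with
  | nil => exact measurable_const
  | cons e p ih =>
    refine Measurable.add ?_ (ih _)
    split_ifs
    · exact measurable_one.indicator measurableSet_Ico
    · exact measurable_const

theorem integrableOn_walkRate (N : Network V A) (T o : ℝ) (p : List A) (a : A) (c : ℝ) :
    IntegrableOn (N.walkRate T o p a) (Set.Ico 0 c) := by
  refine Measure.integrableOn_of_bounded (M := p.length) (by simp)
    (N.measurable_walkRate T o p a).aestronglyMeasurable (Filter.Eventually.of_forall fun x => ?_)
  rw [Real.norm_of_nonneg (N.walkRate_nonneg T o p a x)]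
  exact N.walkRate_le_length T o p a x

/-- The amount of flow sent until time `u` when sending at unit rate during `[0, T)`. -/
def ramp (T u : ℝ) : ℝ := max 0 (min u T)

theorem ramp_nonneg (T u : ℝ) : 0 ≤ ramp T u := le_max_left _ _

theorem ramp_of_le {T u : ℝ} (hT : 0 ≤ T) (h : T ≤ u) : ramp T u = T := by
  rw [ramp, min_eq_right h, max_eq_right hT]

theorem setIntegral_indicator_Ico_eq_ramp {T o : ℝ} (ho : 0 ≤ o) (c : ℝ) :
    ∫ x in Set.Ico 0 c, (Set.Ico o (o + T)).indicator (1 : ℝ → ℝ) x = ramp T (c - o) := by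
  rw [setIntegral_indicator measurableSet_Ico, Set.Ico_inter_Ico]
  simp only [Pi.one_apply, setIntegral_const, smul_eq_mul, mul_one, Real.volume_real_Ico, ramp]
  rw [sup_eq_right.2 ho, max_comm, ← min_sub_sub_right, add_sub_cancel_left]

theorem setIntegral_walkRate_cons (N : Network V A) {T o : ℝ} (ho : 0 ≤ o) (e : A) (p : List A)
    (a : A) (c : ℝ) :
    ∫ x in Set.Ico 0 c, N.walkRate T o (e :: p) a x =
      (if a = e then ramp T (c - o) else 0) +
        ∫ x in Set.Ico 0 c, N.walkRate T (o + N.transit e) p a x := by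
  simp only [walkRate]
  rw [integral_add _ (N.integrableOn_walkRate _ _ _ _ _)]
  · split_ifs
    · rw [setIntegral_indicator_Ico_eq_ramp ho]
    · simp
  · simpa [walkRate, IntegrableOn] using N.integrableOn_walkRate T o [e] a c

theorem setIntegral_walkRate (N : Network V A) {T o θ : ℝ} (hT : 0 ≤ T) (ho : 0 ≤ o) (p : List A)
    (hθ : o + T + (p.map N.transit).sum ≤ θ) (a : A) :
    ∫ x in Set.Ico 0 (θ - N.transit a), N.walkRate T o p a x = T * (p.count a : ℝ) := by
  induction p generalizing o with
  | nil => simp [walkRate]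
  | cons e p ih =>
    have he := N.transit_nonneg e
    have hp : 0 ≤ (p.map N.transit).sum :=
      List.sum_nonneg (by simpa using fun a _ => N.transit_nonneg a)
    simp only [List.map_cons, List.sum_cons] at hθ
    rw [setIntegral_walkRate_cons N ho, ih (by linarith) (by linarith), List.count_cons]
    by_cases h : a = e
    · subst h
      rw [ramp_of_le hT (by linarith)]
      simp; ring
    · simp [h, Ne.symm h]

/-- Flow is conserved at all times at the interior nodes of a walk. -/
theorem excess_walkRate (N : Network V A) {T o θ ξ : ℝ} (hT : 0 ≤ T) (ho : 0 ≤ o) {p : List A}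
    {s t : V} (hp : N.IsWalk s p t) (hθ : o + T + (p.map N.transit).sum ≤ θ) (v : V) :
    N.excess θ (N.walkRate T o p) v ξ =
      (if t = v then ramp T (ξ - o - (p.map N.transit).sum) else 0) -
        if s = v then ramp T (ξ - o) else 0 := by
  induction p generalizing o s with
  | nil => cases hp; simp [excess, walkRate]
  | cons e p ih =>
    obtain ⟨rfl, hp⟩ := hp
    have he := N.transit_nonneg e
    have hp0 : 0 ≤ (p.map N.transit).sum :=
      List.sum_nonneg (by simpa using fun a _ => N.transit_nonneg a)
    simp only [List.map_cons, List.sum_cons] at hθ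
    have h1 := ih (o := o + N.transit e) (by linarith) hp (by linarith)
    have h2 : N.excess θ (N.walkRate T o (e :: p)) v ξ =
        ((if N.head e = v then ramp T (ξ - N.transit e - o) else 0) -
          if N.tail e = v then ramp T (min ξ (θ - N.transit e) - o) else 0) +
          N.excess θ (N.walkRate T (o + N.transit e) p) v ξ := by
      simp only [excess, setIntegral_walkRate_cons N ho, Finset.sum_add_distrib]
      simp only [Finset.sum_ite_eq', Finset.mem_filter, Finset.mem_univ, true_and]
      ring
    -- All flow has entered `e` before `θ - N.transit e`, so truncating the outflow there changes
    -- nothing.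
    have h3 : ramp T (min ξ (θ - N.transit e) - o) = ramp T (ξ - o) := by
      rcases le_total ξ (θ - N.transit e) with h | h
      · rw [min_eq_left h]
      · rw [min_eq_right h, ramp_of_le hT (by linarith), ramp_of_le hT (by linarith)]
    -- The arrival at `N.head e` cancels the departure along the rest of the walk at every time.
    rw [h2, h1, h3, List.map_cons, List.sum_cons,
      show ξ - (o + N.transit e) = ξ - N.transit e - o by ring,
      show ξ - o - (N.transit e + (p.map N.transit).sum) =
        ξ - N.transit e - o - (p.map N.transit).sum by ring]
    ring

theorem setIntegral_sum_const_mul {ι : Type*} [Fintype ι] (k : ι → ℝ) (g : ι → ℝ → ℝ)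
    (c : ℝ) (hg : ∀ i, IntegrableOn (g i) (Set.Ico 0 c)) :
    ∫ x in Set.Ico 0 c, ∑ i, k i * g i x = ∑ i, k i * ∫ x in Set.Ico 0 c, g i x := by
  rw [integral_finsetSum _ fun i _ => (hg i).const_mul (k i)]
  simp only [integral_const_mul]

theorem excess_sum_const_mul (N : Network V A) {ι : Type*} [Fintype ι] (k : ι → ℝ)
    (g : ι → A → ℝ → ℝ) (hg : ∀ i a c, IntegrableOn (g i a) (Set.Ico 0 c)) (θ : ℝ) (v : V)
    (ξ : ℝ) :
    N.excess θ (fun a x => ∑ i, k i * g i a x) v ξ = ∑ i, k i * N.excess θ (g i) v ξ := by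
  simp only [excess, setIntegral_sum_const_mul k (fun i => g i _) _ fun i => hg i _ _, mul_sub,
    Finset.sum_sub_distrib]
  congr 1 <;> rw [Finset.sum_comm] <;> simp only [Finset.mul_sum]

/-- Supplies and demands can be satisfied over time by sending prescribed amounts along given
walks, at rates that are sufficiently small for the capacities. -/
theorem exists_transshipment (N : Network V A) (storage : Bool) {ι : Type*} [Fintype ι]
    {s t : ι → V} {p : ι → List A} (hp : ∀ i, N.IsWalk (s i) (p i) (t i))
    (hs : ∀ i, s i ∈ N.sources) (ht : ∀ i, t i ∈ N.sinks) {z : ι → ℝ} (hz : ∀ i, 0 ≤ z i)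
    (hb : ∀ v, ∑ i, z i * ((if s i = v then 1 else 0) - if t i = v then 1 else 0) = N.b v) :
    ∃ g : N.Transshipment storage, g.cost = ∑ i, z i * N.pathCost (p i) := by
  set K : ℝ := ∑ i, z i * (p i).length with hK
  have hK0 : 0 ≤ K := Finset.sum_nonneg fun i _ => mul_nonneg (hz i) (Nat.cast_nonneg _)
  have hKc : ∀ a, 0 ≤ K / N.capacity a := fun a => div_nonneg hK0 (N.capacity_pos a).le
  -- Sending `z i` at rate `z i / T` loads an arc with at most `K / T`, which is within every
  -- capacity since `T ≥ K / N.capacity a`. The `1` keeps `T` positive.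
  set T : ℝ := 1 + ∑ a, K / N.capacity a with hTdef
  have hT : 0 < T := by
    have := Finset.sum_nonneg fun a (_ : a ∈ Finset.univ) => hKc a
    linarith
  have hKT : ∀ a, K / T ≤ N.capacity a := by
    intro a
    have h1 := Finset.single_le_sum (fun a _ => hKc a) (Finset.mem_univ a)
    rw [div_le_comm₀ hT (N.capacity_pos a)]
    linarith
  have htr : ∀ i, 0 ≤ ((p i).map N.transit).sum := fun i =>
    List.sum_nonneg (by simpa using fun a _ => N.transit_nonneg a)
  -- Long enough for the last flow to arrive along every walk.
  set θ : ℝ := T + ∑ i, ((p i).map N.transit).sum with hθdef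
  have hθ : ∀ i, 0 + T + ((p i).map N.transit).sum ≤ θ := by
    intro i
    have := Finset.single_le_sum (fun i _ => htr i) (Finset.mem_univ i)
    linarith
  have hTθ : T ≤ θ := by
    have := Finset.sum_nonneg fun i (_ : i ∈ Finset.univ) => htr i
    linarith
  set rate : A → ℝ → ℝ := fun a x => ∑ i, z i / T * N.walkRate T 0 (p i) a x with hrate
  have hex : ∀ v ξ, N.excess θ rate v ξ = ∑ i, z i / T *
      ((if t i = v then ramp T (ξ - ((p i).map N.transit).sum) else 0) -
        if s i = v then ramp T ξ else 0) := by
    intro v ξ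
    rw [hrate, N.excess_sum_const_mul _ _ fun i a c => N.integrableOn_walkRate _ _ _ _ _]
    refine Finset.sum_congr rfl fun i _ => ?_
    rw [N.excess_walkRate hT.le le_rfl (hp i) (hθ i)]
    simp
  have hnonneg : ∀ i, 0 ≤ z i / T := fun i => div_nonneg (hz i) hT.le
  let g : N.Transshipment storage :=
    { horizon := θ
      rate := rate
      horizon_nonneg := hT.le.trans hTθ
      measurable := fun a => (Finset.measurable_sum _ fun i _ =>
        (N.measurable_walkRate T 0 (p i) a).const_mul _).aemeasurable
      nonneg := fun a x _ => Finset.sum_nonneg fun i _ =>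
        mul_nonneg (hnonneg i) (N.walkRate_nonneg _ _ _ _ _)
      le_capacity := fun a x _ => by
        refine le_trans ?_ (hKT a)
        rw [hK, Finset.sum_div]
        refine Finset.sum_le_sum fun i _ => ?_
        rw [mul_div_right_comm]
        exact mul_le_mul_of_nonneg_left (N.walkRate_le_length _ _ _ _ _) (hnonneg i)
      no_deficit := fun v hv ξ _ => by
        rw [hex v ξ]
        refine Finset.sum_nonneg fun i _ => mul_nonneg (hnonneg i) ?_
        have : s i ≠ v := fun h => hv (h ▸ hs i)
        rw [if_neg this, sub_zero]
        split_ifs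
        · exact ramp_nonneg _ _
        · exact le_rfl
      no_storage := fun _ v hv hv' ξ _ => by
        rw [hex v ξ]
        refine Finset.sum_eq_zero fun i _ => ?_
        have h1 : s i ≠ v := fun h => hv (h ▸ hs i)
        have h2 : t i ≠ v := fun h => hv' (h ▸ ht i)
        simp [h1, h2]
      satisfies := fun v => by
        rw [hex v θ, ← hb v, ← Finset.sum_neg_distrib]
        refine Finset.sum_congr rfl fun i _ => ?_
        rw [ramp_of_le hT.le hTθ, ramp_of_le hT.le (by linarith [hθ i])]
        have hT' := hT.ne'
        split_ifs <;> field_simp <;> ring }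
  refine ⟨g, ?_⟩
  have hamount : ∀ a, g.amount a = ∑ i, z i * ((p i).count a : ℝ) := by
    intro a
    change ∫ x in Set.Ico 0 (θ - N.transit a), ∑ i, z i / T * N.walkRate T 0 (p i) a x = _
    rw [setIntegral_sum_const_mul _ (fun i => N.walkRate T 0 (p i) a) _
      fun i => N.integrableOn_walkRate _ _ _ _ _]
    refine Finset.sum_congr rfl fun i _ => ?_
    rw [N.setIntegral_walkRate hT.le le_rfl _ (hθ i), ← mul_assoc, div_mul_cancel₀ _ hT.ne']
  simp only [Transshipment.cost, hamount, Finset.mul_sum]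
  rw [Finset.sum_comm]
  refine Finset.sum_congr rfl fun i _ => ?_
  rw [pathCost, ← sum_mul_count, Finset.mul_sum]
  exact Finset.sum_congr rfl fun a _ => by ring

/-! ### Costs of transshipments over time -/

namespace Transshipment

variable {N : Network V A} {storage : Bool}

theorem amount_nonneg (f : N.Transshipment storage) (a : A) : 0 ≤ f.amount a :=
  setIntegral_nonneg measurableSet_Ico (f.nonneg a)

/-- At time `θ` both integrals in `excess` run over `[0, θ - τ a)`, since transit times are
nonnegative. -/
theorem isFlow_amount (f : N.Transshipment storage) : N.IsFlow f.amount N.b := by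
  refine IsFlow.of_net fun v => ?_
  rw [← f.satisfies v, excess]
  congr 1
  refine Finset.sum_congr rfl fun a _ => ?_
  rw [min_eq_right (sub_le_self _ (N.transit_nonneg a)), amount]

theorem nonempty_decomposition (f : N.Transshipment storage) : Nonempty f.Decomposition := by
  obtain ⟨P, C, hP, hC, hP', hC', h⟩ := f.isFlow_amount.exists_decomposition _ f.amount_nonneg
    (fun v hv => by
      by_contra hs
      by_cases ht : v ∈ N.sinks
      · linarith [N.demand_pos v ht]
      · exact hv.ne' (N.b_eq_zero v hs ht))
    (fun v hv => by
      by_contra ht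
      by_cases hs : v ∈ N.sources
      · linarith [N.supply_pos v hs]
      · exact hv.ne (N.b_eq_zero v hs ht))
    le_rfl
  exact ⟨⟨P, C, hP, hC, hP', hC', h⟩⟩

/-- The weights are arbitrary because both costs and potential differences are inserted. -/
theorem Decomposition.sum_mul_amount {f : N.Transshipment storage} (d : f.Decomposition)
    (c : A → ℝ) :
    ∑ a, c a * f.amount a = ∑ p ∈ d.onPath.support, d.onPath p * (p.map c).sum +
      ∑ p ∈ d.onCycle.support, d.onCycle p * (p.map c).sum := by
  have key : ∀ P : List A →₀ ℝ, ∑ a, c a * (P.sum fun p r => r * (p.count a : ℝ)) =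
      ∑ p ∈ P.support, P p * (p.map c).sum := by
    intro P
    simp only [Finsupp.sum, Finset.mul_sum, ← sum_mul_count]
    rw [Finset.sum_comm]
    exact Finset.sum_congr rfl fun p _ => Finset.sum_congr rfl fun a _ => by ring
  simp only [d.amount_eq, mul_add, Finset.sum_add_distrib, key]

/-- The gap between the cost of a transshipment over time and the value of a dual solution. -/
theorem Decomposition.cost_sub_dualObjective {f : N.Transshipment storage} (d : f.Decomposition)
    (y : V → ℝ) :
    f.cost - N.dualObjective y =
      ∑ p ∈ d.onPath.support, d.onPath p *
        (N.pathCost p - (p.map fun a => y (N.tail a) - y (N.head a)).sum) +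
      ∑ p ∈ d.onCycle.support, d.onCycle p * N.pathCost p := by
  have h1 := f.isFlow_amount y
  rw [d.sum_mul_amount] at h1
  have h2 : ∑ p ∈ d.onCycle.support,
      d.onCycle p * (p.map fun a => y (N.tail a) - y (N.head a)).sum = 0 := by
    refine Finset.sum_eq_zero fun p hp => ?_
    obtain ⟨v, hv⟩ := (d.isCycle p hp).2.1
    rw [hv.sum_potential y, sub_self, mul_zero]
  rw [dualObjective_eq, cost, d.sum_mul_amount, ← h1, h2]
  simp only [mul_sub, Finset.sum_sub_distrib, pathCost]
  ring

/-- Weak duality with complementary slackness: a sum of nonnegative terms vanishes iff each term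
does, and amounts on the support are nonzero. -/
theorem Decomposition.dualObjective_le_cost_and_eq_iff {f : N.Transshipment storage}
    (d : f.Decomposition) (hN : N.Conservative) {y : V → ℝ} (hy : N.DualFeasible y) :
    N.dualObjective y ≤ f.cost ∧ (f.cost = N.dualObjective y ↔ d.OnlyAdmissible y) := by
  have hgap := d.cost_sub_dualObjective y
  have hbar : ∀ {p s t}, s ∈ N.sources → t ∈ N.sinks → N.IsPath s p t →
      y s - y t ≤ N.barCost s t ∧ N.barCost s t ≤ N.pathCost p := fun {p s t} hs ht hp =>
    ⟨hy s t ⟨hs, ht, p, hp⟩, (N.barCost_isLeast ⟨p, hp⟩).2 ⟨p, hp, rfl⟩⟩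
  have hpath : ∀ p ∈ d.onPath.support, 0 ≤ d.onPath p *
      (N.pathCost p - (p.map fun a => y (N.tail a) - y (N.head a)).sum) := by
    intro p hp
    obtain ⟨s, hs, t, ht, hst⟩ := d.isPath p hp
    refine mul_nonneg (d.onPath_nonneg p) ?_
    rw [hst.1.sum_potential y]
    have := hbar hs ht hst
    linarith
  have hcycle : ∀ p ∈ d.onCycle.support, 0 ≤ d.onCycle p * N.pathCost p := fun p hp =>
    mul_nonneg (d.onCycle_nonneg p) (hN p (d.isCycle p hp))
  have hpath' := Finset.sum_nonneg hpath
  have hcycle' := Finset.sum_nonneg hcycle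
  refine ⟨by linarith, ?_⟩
  have heq : f.cost = N.dualObjective y ↔
      (∀ p ∈ d.onPath.support, d.onPath p *
        (N.pathCost p - (p.map fun a => y (N.tail a) - y (N.head a)).sum) = 0) ∧
      ∀ p ∈ d.onCycle.support, d.onCycle p * N.pathCost p = 0 := by
    rw [← Finset.sum_eq_zero_iff_of_nonneg hpath, ← Finset.sum_eq_zero_iff_of_nonneg hcycle,
      ← add_eq_zero_iff_of_nonneg hpath' hcycle', ← hgap, sub_eq_zero]
  rw [heq]
  refine and_congr (forall₂_congr fun p hp => ?_) (forall₂_congr fun p hp => ?_)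
  · rw [mul_eq_zero, or_iff_right (Finsupp.mem_support_iff.1 hp)]
    constructor
    -- Here `y s - y t = N.pathCost p`, so both inequalities of `y s - y t ≤ N.barCost s t ≤
    -- N.pathCost p` are tight.
    · intro h s hs t ht hst
      rw [hst.1.sum_potential y] at h
      have := hbar hs ht hst
      exact ⟨⟨⟨hs, ht, p, hst⟩, by linarith⟩, hst, by linarith⟩
    · intro h
      obtain ⟨s, hs, t, ht, hst⟩ := d.isPath p hp
      obtain ⟨h1, _, h2⟩ := h s hs t ht hst
      rw [hst.1.sum_potential y, h2, h1.2, sub_self]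
  · rw [mul_eq_zero, or_iff_right (Finsupp.mem_support_iff.1 hp)]

end Transshipment

/-- The value of an optimal dual solution is attained as cost of a transshipment over time. -/
theorem DualOptimal.exists_cost_eq {N : Network V A} {y : V → ℝ} (hy : N.DualOptimal y)
    (storage : Bool) : ∃ g : N.Transshipment storage, g.cost = N.dualObjective y := by
  classical
  obtain ⟨z, hz, hzb⟩ := hy.exists_transportation
  simp only [finsum_eq_sum_of_fintype] at hzb
  choose p hp hpc using fun i : {st : V × V // N.Active y st.1 st.2} =>
    (N.barCost_isLeast i.2.1.2.2).1
  obtain ⟨g, hg⟩ := N.exists_transshipment storage (fun i => (hp i).1) (fun i => i.2.1.1)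
    (fun i => i.2.1.2.1) hz hzb
  refine ⟨g, ?_⟩
  rw [hg, dualObjective_eq]
  simp only [← hzb, Finset.mul_sum]
  rw [Finset.sum_comm]
  refine Finset.sum_congr rfl fun i _ => ?_
  -- On an active pair the cheapest path costs exactly `y s - y t`.
  rw [hpc, ← i.2.2]
  simp only [mul_left_comm _ (z i), ← Finset.mul_sum]
  simp [mul_sub, Finset.sum_sub_distrib]

/-- The dual value bounds every cost from below and is attained within the same storage model. -/
theorem Transshipment.isMinCost_iff {N : Network V A} (hN : N.Conservative) {y : V → ℝ}
    (hy : N.DualOptimal y) {storage : Bool} (f : N.Transshipment storage) :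
    f.IsMinCost ↔ f.cost = N.dualObjective y := by
  have hle : ∀ g : N.Transshipment storage, N.dualObjective y ≤ g.cost := fun g =>
    g.nonempty_decomposition.elim fun d => (d.dualObjective_le_cost_and_eq_iff hN hy.1).1
  constructor
  · intro h
    obtain ⟨g, hg⟩ := hy.exists_cost_eq storage
    exact le_antisymm (hg ▸ h g) (hle f)
  · intro h g
    rw [h]
    exact hle g

end Network
end FlowsOverTime
end

theorem mainTheorem4 {V A : Type*} [Fintype V] [DecidableEq V] [Fintype A] [DecidableEq A]
    (N : FlowsOverTime.Network V A) (hN : N.Conservative)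
    (y : V → ℝ) (hy : N.DualOptimal y)
    (storage : Bool) (f : N.Transshipment storage) :
    (f.IsMinCost ↔ ∃ d : f.Decomposition, d.OnlyAdmissible y) ∧
      (f.IsMinCost ↔ ∀ d : f.Decomposition, d.OnlyAdmissible y) := by
  have h : ∀ d : f.Decomposition, f.IsMinCost ↔ d.OnlyAdmissible y := fun d =>
    (f.isMinCost_iff hN hy).trans (d.dualObjective_le_cost_and_eq_iff hN hy.1).2
  obtain ⟨d⟩ := f.nonempty_decomposition
  exact ⟨⟨fun hf => ⟨d, (h d).1 hf⟩, fun ⟨d', hd'⟩ => (h d').2 hd'⟩,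
    ⟨fun hf d' => (h d').1 hf, fun hf => (h d).2 (hf d)⟩⟩
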